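/- Let $n,m\ge 1$, let $A_1,\dots,A_m\in\mathbb R^{n\times n}$ be symmetric, let $a_1,\dots,a_m\in\mathbb R^n$, and let $f=(f_1,\dots,f_m):\mathbb R^n\to\mathbb R^m$ with $f_i(x)=\tfrac12x^TA_ix+a_i^Tx$. For real $\epsilon$ let $F_m(\epsilon)=\{f(x): x\in\mathbb R^n,\ \|x\|\le\epsilon\}$, where $\|\cdot\|$ is the Euclidean norm. Put $A=[a_1\ \dots\ a_m]\in\mathbb R^{n\times m}$ and $\nu=\sqrt{\lambda_{\min}(A^TA)}$. Write $M\bullet N=\operatorname{trace}(MN^T)$, $S=\sum_{i=1}^mA_i^TA_i$, and for symmetric $Z\in\mathbb R^{n^2\times n^2}$ $$B(Z)=\frac1m\sqrt{(S\otimes S)\bullet Z}+\sqrt{\frac{m-1}{m}}\,\sqrt{\Big(\sum_{i,j=1}^m(A_i^TA_j)\otimes(A_i^TA_j)-\frac1m\,S\otimes S\Big)\bullet Z}\,.$$ Let $\widetilde L_{\rm new}\ge 0$ be the number whose square is the optimal value of $$\max\ B(Z)\quad\text{s.t.}\quad \operatorname{trace}(Z)=1,\quad \operatorname{vec}(I)^TZ\operatorname{vec}(I)=1,\quad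 \|Z\operatorname{vec}(I)\|\le 1,\quad Z\succeq 0,$$ where, as usual, only those $Z$ are admitted for which $B(Z)$ is defined, that is, both radicands that depend on $Z$ are nonnegative. Then: 1. The program is convex (its feasible set is convex and $B$ is concave on it), and its maximum is attained. 2. The program relaxes the trace-based disk bound: for every $y\in\mathbb R^n$ with $\|y\|=1$, put $G_y=[A_1y\ \dots\ A_my]^T[A_1y\ \dots\ A_my]$ and $z=y\otimes y$. Then $Z=zz^T$ is feasible and $$\lambda_{\max}(G_y)\ \le\ \frac{\operatorname{trace}(G_y)}m+\sqrt{\frac{m-1}m\Big(\operatorname{trace}(G_y^TG_y)-\frac{(\operatorname{trace}G_y)^2}{m}\Big)}\ =\ B(zz^T).$$ 3. For every $\epsilon<\nu/(2\widetilde L_{\rm new})$ the set $F_m(\epsilon)$ is convex. (The condition is read as $2\widetilde L_{\rm new}\,\epsilon<\nu$, so the bound is $+\infty$ if $\widetilde L_{\rm new}=0<\nu$.) -/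

import Mathlib

open scoped Kronecker

noncomputable section

namespace QuadraticMap_Local

variable {n m : ℕ}

/-- The quadratic map `f = (f_1, …, f_m)` with `f_i(x) = ½ xᵀ A_i x + a_iᵀ x`. -/
def quadMap (A : Fin m → Matrix (Fin n) (Fin n) ℝ) (a : Fin m → Fin n → ℝ)
    (x : EuclideanSpace ℝ (Fin n)) : EuclideanSpace ℝ (Fin m) :=
  WithLp.toLp 2 fun i => (1 / 2 : ℝ) * (x.ofLp ⬝ᵥ (A i).mulVec x.ofLp) + a i ⬝ᵥ x.ofLp

/-- `F_m(ε) = {f(x) : ‖x‖ ≤ ε}` (Euclidean norm). -/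
def ballImage (A : Fin m → Matrix (Fin n) (Fin n) ℝ) (a : Fin m → Fin n → ℝ) (ε : ℝ) :
    Set (EuclideanSpace ℝ (Fin m)) :=
  {p | ∃ x : EuclideanSpace ℝ (Fin n), ‖x‖ ≤ ε ∧ quadMap A a x = p}

/-- Smallest eigenvalue of a real symmetric matrix of positive size. -/
def lambdaMin {k : ℕ} (M : Matrix (Fin k) (Fin k) ℝ) : ℝ := sInf (spectrum ℝ M)

/-- Largest eigenvalue of a real symmetric matrix of positive size. -/
def lambdaMax {k : ℕ} (M : Matrix (Fin k) (Fin k) ℝ) : ℝ := sSup (spectrum ℝ M)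

/-- The `n × m` matrix with columns `v_1, …, v_m`. -/
def colMatrix (v : Fin m → Fin n → ℝ) : Matrix (Fin n) (Fin m) ℝ :=
  Matrix.of fun k i => v i k

/-- `ν = σ_min([a_1 … a_m]) = √λ_min([a_1 … a_m]ᵀ [a_1 … a_m])`; it is `0` if `m > n`. -/
def nu (a : Fin m → Fin n → ℝ) : ℝ :=
  Real.sqrt (lambdaMin ((colMatrix a).transpose * colMatrix a))

/-- The inner product of matrices `M • N = trace (M Nᵀ)`. -/
def matInner {ι : Type*} [Fintype ι] (M N : Matrix ι ι ℝ) : ℝ :=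
  Matrix.trace (M * N.transpose)

/-- `S = ∑ᵢ A_iᵀ A_i`. -/
def gramSum (A : Fin m → Matrix (Fin n) (Fin n) ℝ) : Matrix (Fin n) (Fin n) ℝ :=
  ∑ i, (A i).transpose * A i

/-- `S ⊗ S`. -/
def kronOne (A : Fin m → Matrix (Fin n) (Fin n) ℝ) :
    Matrix (Fin n × Fin n) (Fin n × Fin n) ℝ :=
  gramSum A ⊗ₖ gramSum A

/-- `∑ᵢⱼ (A_iᵀ A_j) ⊗ (A_iᵀ A_j) - (1/m) S ⊗ S`. -/
def kronTwo (A : Fin m → Matrix (Fin n) (Fin n) ℝ) :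
    Matrix (Fin n × Fin n) (Fin n × Fin n) ℝ :=
  (∑ i, ∑ j, ((A i).transpose * A j) ⊗ₖ ((A i).transpose * A j))
    - (1 / (m : ℝ)) • kronOne A

/-- The objective function `B(Z)` of the semidefinite program. -/
def objective (A : Fin m → Matrix (Fin n) (Fin n) ℝ)
    (Z : Matrix (Fin n × Fin n) (Fin n × Fin n) ℝ) : ℝ :=
  (1 / (m : ℝ)) * Real.sqrt (matInner (kronOne A) Z)
    + Real.sqrt (((m : ℝ) - 1) / m) * Real.sqrt (matInner (kronTwo A) Z)

/-- The set of `Z` at which the square roots in `B(Z)` are defined over the reals. `B` is concave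
on this set; without it `Real.sqrt` would silently count the root of a negative number as `0`. -/
def objectiveDomain (A : Fin m → Matrix (Fin n) (Fin n) ℝ) :
    Set (Matrix (Fin n × Fin n) (Fin n × Fin n) ℝ) :=
  {Z | 0 ≤ matInner (kronOne A) Z ∧ 0 ≤ matInner (kronTwo A) Z}

/-- The vector `vec(I)` of length `n²`. -/
def vecId (n : ℕ) : Fin n × Fin n → ℝ := Matrix.vec (1 : Matrix (Fin n) (Fin n) ℝ)

/-- The constraints `trace Z = 1`, `vec(I)ᵀ Z vec(I) = 1`, `‖Z vec(I)‖ ≤ 1`, `Z ⪰ 0`. -/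
def constraintSet (n : ℕ) : Set (Matrix (Fin n × Fin n) (Fin n × Fin n) ℝ) :=
  {Z | Z.trace = 1 ∧ vecId n ⬝ᵥ Z.mulVec (vecId n) = 1 ∧
    ‖WithLp.toLp 2 (Z.mulVec (vecId n))‖ ≤ 1 ∧ Z.PosSemidef}

/-- The feasible points of the program: the constraints hold and the objective is defined. -/
def feasibleSet (A : Fin m → Matrix (Fin n) (Fin n) ℝ) :
    Set (Matrix (Fin n × Fin n) (Fin n × Fin n) ℝ) :=
  constraintSet n ∩ objectiveDomain A

/-- `L̃_new`, the square root of the optimal value of the program. -/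
def LTilde (A : Fin m → Matrix (Fin n) (Fin n) ℝ) : ℝ :=
  Real.sqrt (sSup (objective A '' feasibleSet A))

/-- `[A_1 y … A_m y]ᵀ [A_1 y … A_m y]`. -/
def gramAt (A : Fin m → Matrix (Fin n) (Fin n) ℝ) (y : EuclideanSpace ℝ (Fin n)) :
    Matrix (Fin m) (Fin m) ℝ :=
  (colMatrix fun i => (A i).mulVec y.ofLp).transpose * colMatrix fun i => (A i).mulVec y.ofLp

/-- The right end of the disk that contains all eigenvalues of an `m × m` matrix `M`:
`trace(M)/m + √((m-1)/m · (trace(MᵀM) - trace(M)²/m))`. -/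
def traceDiskBound (M : Matrix (Fin m) (Fin m) ℝ) : ℝ :=
  M.trace / m + Real.sqrt ((((m : ℝ) - 1) / m) *
    ((M.transpose * M).trace - M.trace ^ 2 / m))

/-- `Z = z zᵀ` with `z = y ⊗ y`. -/
def liftPoint (y : EuclideanSpace ℝ (Fin n)) :
    Matrix (Fin n × Fin n) (Fin n × Fin n) ℝ :=
  Matrix.vecMulVec (fun p => y.ofLp p.1 * y.ofLp p.2) (fun p => y.ofLp p.1 * y.ofLp p.2)

end QuadraticMap_Local

end

/-! Convexity of the image is Polyak's principle. Let `y` be a convex combination of `f x₁`, `f x₂`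
and `x₀` the same combination of `x₁`, `x₂`. Round balls are strongly convex, so a ball of radius
`ρ` about `x₀`, with `ρ` proportional to `s * t * ‖x₁ - x₂‖ ^ 2`, stays in the large ball, while `f
x₀` misses `y` by at most `L * ε * ρ`. The adjoint of the derivative of `f` is bounded below by `ν -
L * ε > ν / 2` there, enough to solve `f x = y` within `ρ` of `x₀`. The solution is a minimiser of
the residual plus `ν / 2` times the distance to `x₀` (`convex_quadratic_image_ball`,
`eq_of_local_min_norm`).

The Lipschitz constant `L` of the derivative comes from the program: for a unit vector `x` the
squared operator norm of `hessian A x` is at most the largest eigenvalue of `gramAt A x`.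
Samuelson's inequality for the eigenvalues bounds this by the trace disk, which is the objective at
the feasible point `liftPoint x`, hence at most `LTilde A ^ 2`. -/

namespace QuadraticMap_Local
open scoped InnerProductSpace

/-! ### Polyak's principle by penalised minimisation -/

section QuadraticImage

variable {E F : Type*} [NormedAddCommGroup E] [InnerProductSpace ℝ E] [FiniteDimensional ℝ E]
  [NormedAddCommGroup F] [InnerProductSpace ℝ F] [FiniteDimensional ℝ F]

/-- At a point that minimises `‖f x - y‖ + c ‖x - x₀‖` locally, we have `f x = y` if the
derivative of `f` at that point has an adjoint bounded below by more than `c`. -/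
theorem eq_of_local_min_norm {f : E → F} {J : E →L[ℝ] F} {q : E → F} {x x₀ : E} {y : F}
    {c μ δ : ℝ} (hδ : 0 < δ) (hcμ : c < μ)
    (hq : ∀ (s : ℝ) (h : E), f (x + s • h) = f x + s • J h + s ^ 2 • q h)
    (hμ : ∀ w, μ * ‖w‖ ≤ ‖J.adjoint w‖) (hc : 0 < c)
    (hmin : ∀ z, ‖z - x‖ < δ → ‖f x - y‖ + c * ‖x - x₀‖ ≤ ‖f z - y‖ + c * ‖z - x₀‖) :
    f x = y := by
  by_contra hne
  set r := f x - y with hr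
  have hr0 : 0 < ‖r‖ := norm_pos_iff.2 (sub_ne_zero.2 hne)
  set g := J.adjoint r with hg
  have hgr : μ * ‖r‖ ≤ ‖g‖ := hμ r
  have hg0 : 0 < ‖g‖ := lt_of_lt_of_le (mul_pos (hc.trans hcμ) hr0) hgr
  -- Descent along `-J* r`: to first order the residual norm falls at rate `‖g‖ ^ 2 / ‖r‖ ≥ μ *
  -- ‖g‖`, faster than the penalty can grow, which is at rate at most `c * ‖g‖`.
  have hexp : ∀ s : ℝ, ‖f (x + (-s) • g) - y‖ ^ 2 = ‖r‖ ^ 2 - 2 * s * ‖g‖ ^ 2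
      + s * (s * (2 * ⟪r, q g⟫_ℝ + ‖-J g + s • q g‖ ^ 2)) := by
    intro s
    have h1 : f (x + (-s) • g) - y = r + s • (-J g + s • q g) := by
      rw [hq, hr]; module
    have h2 : ⟪r, J g⟫_ℝ = ‖g‖ ^ 2 := by
      rw [← ContinuousLinearMap.adjoint_inner_left, ← hg, real_inner_self_eq_norm_sq]
    rw [h1, norm_add_sq_real, norm_smul, inner_smul_right, inner_add_right, inner_neg_right,
      inner_smul_right, h2, mul_pow, Real.norm_eq_abs, sq_abs]
    ring
  have hlim : Filter.Tendsto (fun s : ℝ => -2 * ‖g‖ ^ 2 + 2 * c * ‖g‖ * ‖r‖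
      + s * (2 * ⟪r, q g⟫_ℝ + ‖-J g + s • q g‖ ^ 2)) (nhdsWithin 0 (Set.Ioi 0))
      (nhds (-2 * ‖g‖ ^ 2 + 2 * c * ‖g‖ * ‖r‖)) := by
    have : Continuous (fun s : ℝ => -2 * ‖g‖ ^ 2 + 2 * c * ‖g‖ * ‖r‖
      + s * (2 * ⟪r, q g⟫_ℝ + ‖-J g + s • q g‖ ^ 2)) := by fun_prop
    have h := (this.tendsto 0).mono_left (nhdsWithin_le_nhds (s := Set.Ioi 0))
    simpa using h
  have hev : ∀ᶠ s : ℝ in nhdsWithin 0 (Set.Ioi 0), 0 ≤ -2 * ‖g‖ ^ 2 + 2 * c * ‖g‖ * ‖r‖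
      + s * (2 * ⟪r, q g⟫_ℝ + ‖-J g + s • q g‖ ^ 2) := by
    -- The second bound on `s` keeps the trial point in the `δ`-ball; the third keeps `‖r‖ - s * (c
    -- * ‖g‖)` positive, so that it may be squared.
    filter_upwards [self_mem_nhdsWithin,
      nhdsWithin_le_nhds (Iio_mem_nhds (div_pos hδ hg0)),
      nhdsWithin_le_nhds (Iio_mem_nhds (div_pos hr0 (mul_pos hc hg0)))] with s h0 h1 h2
    simp only [Set.mem_Ioi, Set.mem_Iio] at h0 h1 h2
    rw [lt_div_iff₀ hg0] at h1
    rw [lt_div_iff₀ (mul_pos hc hg0)] at h2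
    have hns : ‖(-s) • g‖ = s * ‖g‖ := by
      rw [norm_smul, norm_neg, Real.norm_of_nonneg h0.le]
    have h3 := hmin (x + (-s) • g) (by rwa [add_sub_cancel_left, hns])
    have h4 : ‖x + (-s) • g - x₀‖ ≤ ‖x - x₀‖ + s * ‖g‖ := by
      rw [← hns]
      calc _ = ‖(x - x₀) + (-s) • g‖ := by congr 1; abel
        _ ≤ _ := norm_add_le _ _
    have h5 : ‖r‖ - s * (c * ‖g‖) ≤ ‖f (x + (-s) • g) - y‖ := by
      nlinarith [mul_le_mul_of_nonneg_left h4 hc.le]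
    have h6 := pow_le_pow_left₀ (by linarith) h5 2
    rw [hexp] at h6
    have h7 : 0 ≤ (s * (c * ‖g‖)) ^ 2 := sq_nonneg _
    have h8 : 0 ≤ s * (-2 * ‖g‖ ^ 2 + 2 * c * ‖g‖ * ‖r‖
      + s * (2 * ⟪r, q g⟫_ℝ + ‖-J g + s • q g‖ ^ 2)) := by nlinarith
    exact nonneg_of_mul_nonneg_right h8 h0
  have h := ge_of_tendsto hlim hev
  have h1 : ‖g‖ * ‖g‖ ≤ ‖g‖ * (c * ‖r‖) := by nlinarith
  have h2 := le_of_mul_le_mul_left h1 hg0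
  have h3 := mul_lt_mul_of_pos_right hcμ hr0
  linarith

/-- **Polyak's principle** for quadratic maps: the image of a small ball is convex. -/
theorem convex_quadratic_image_ball (l : E →L[ℝ] F) (b : E →L[ℝ] E →L[ℝ] F)
    (hsymm : ∀ x y, b x y = b y x) {L ν ε : ℝ} (hL : 0 ≤ L)
    (hb : ∀ x, ‖b x‖ ≤ L * ‖x‖) (hl : ∀ w, ν * ‖w‖ ≤ ‖l.adjoint w‖) (hε : 2 * L * ε < ν) :
    Convex ℝ ((fun x => l x + (1 / 2 : ℝ) • b x x) '' Metric.closedBall 0 ε) := by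
  rcases lt_trichotomy ε 0 with h | rfl | hε0
  · rw [Metric.closedBall_eq_empty.2 h, Set.image_empty]; exact convex_empty
  · rw [Metric.closedBall_zero, Set.image_singleton]; exact convex_singleton _
  set f : E → F := fun x => l x + (1 / 2 : ℝ) • b x x with hf
  have hcont : Continuous f := by fun_prop
  have hν : 0 < ν := lt_of_le_of_lt (by positivity) hε
  rintro _ ⟨x₁, hx₁, rfl⟩ _ ⟨x₂, hx₂, rfl⟩ s t hs ht hst
  rw [mem_closedBall_zero_iff] at hx₁ hx₂
  set x₀ := s • x₁ + t • x₂ with hx₀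
  set y := s • f x₁ + t • f x₂ with hy
  -- Since `‖x₀‖ ^ 2 ≤ ε ^ 2 - s * t * ‖x₁ - x₂‖ ^ 2 = ε ^ 2 - 2 * ε * ρ ≤ (ε - ρ) ^ 2`, this radius
  -- fits.
  set ρ := s * t * ‖x₁ - x₂‖ ^ 2 / (2 * ε) with hρ
  have hρ0 : 0 ≤ ρ := by positivity
  have hρε : ρ * (2 * ε) = s * t * ‖x₁ - x₂‖ ^ 2 := div_mul_cancel₀ _ (by positivity)
  obtain rfl : t = 1 - s := by linarith
  have hst4 : s * (1 - s) ≤ 1 / 4 := by nlinarith [sq_nonneg (s - 1 / 2)]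
  have hx₀ρ : ‖x₀‖ + ρ ≤ ε := by
    have hd : ‖x₁ - x₂‖ ≤ 2 * ε := (norm_sub_le _ _).trans (by linarith)
    have hd2 : ‖x₁ - x₂‖ ^ 2 ≤ (2 * ε) ^ 2 := pow_le_pow_left₀ (norm_nonneg _) hd 2
    have h1 : ρ * (2 * ε) ≤ ε * (2 * ε) := by
      rw [hρε]
      nlinarith [mul_nonneg hs ht, sq_nonneg ε]
    have h2 : ρ ≤ ε := le_of_mul_le_mul_right h1 (by positivity)
    have h3 : ‖x₀‖ ^ 2 = s * ‖x₁‖ ^ 2 + (1 - s) * ‖x₂‖ ^ 2 - s * (1 - s) * ‖x₁ - x₂‖ ^ 2 := by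
      rw [hx₀, norm_add_sq_real, norm_sub_sq_real, norm_smul, norm_smul, inner_smul_left,
        inner_smul_right, mul_pow, mul_pow, Real.norm_eq_abs, Real.norm_eq_abs, sq_abs, sq_abs]
      simp only [conj_trivial]
      ring
    have h4 : ‖x₁‖ ^ 2 ≤ ε ^ 2 := pow_le_pow_left₀ (norm_nonneg _) hx₁ 2
    have h5 : ‖x₂‖ ^ 2 ≤ ε ^ 2 := pow_le_pow_left₀ (norm_nonneg _) hx₂ 2
    have h6 : ‖x₀‖ ^ 2 ≤ (ε - ρ) ^ 2 := by
      nlinarith [mul_le_mul_of_nonneg_left h4 hs, mul_le_mul_of_nonneg_left h5 ht, sq_nonneg ρ]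
    have h7 := abs_le_of_sq_le_sq h6 (by linarith)
    rw [abs_of_nonneg (norm_nonneg _)] at h7
    linarith
  have hsub : ∀ z ∈ Metric.closedBall x₀ ρ, ‖z‖ ≤ ε := by
    intro z hz
    rw [mem_closedBall_iff_norm] at hz
    calc ‖z‖ = ‖x₀ + (z - x₀)‖ := by congr 1; abel
      _ ≤ ‖x₀‖ + ‖z - x₀‖ := norm_add_le _ _
      _ ≤ ε := by linarith
  have hfy : ‖f x₀ - y‖ ≤ L * ε * ρ := by
    have h1 : f x₀ - y = -(s * (1 - s) / 2) • b (x₁ - x₂) (x₁ - x₂) := by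
      simp only [hf, hy, hx₀, map_add, map_sub, map_smul, _root_.add_apply,
        _root_.sub_apply, _root_.smul_apply, hsymm x₂ x₁]
      module
    have h2 : ‖b (x₁ - x₂) (x₁ - x₂)‖ ≤ L * ‖x₁ - x₂‖ * ‖x₁ - x₂‖ :=
      ((b _).le_opNorm _).trans (mul_le_mul_of_nonneg_right (hb _) (norm_nonneg _))
    have h3 : 0 ≤ s * (1 - s) := mul_nonneg hs ht
    rw [h1, norm_smul, norm_neg, Real.norm_of_nonneg (by positivity)]
    calc _ ≤ s * (1 - s) / 2 * (L * ‖x₁ - x₂‖ * ‖x₁ - x₂‖) := by gcongr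
      _ = L / 2 * (s * (1 - s) * ‖x₁ - x₂‖ ^ 2) := by ring
      _ = _ := by rw [← hρε]; ring
  obtain ⟨x, hxmem, hxmin⟩ := (isCompact_closedBall x₀ ρ).exists_isMinOn
    (Metric.nonempty_closedBall.2 hρ0)
    (f := fun z => ‖f z - y‖ + ν / 2 * ‖z - x₀‖) (by fun_prop)
  refine ⟨x, mem_closedBall_zero_iff.2 (hsub x hxmem), ?_⟩
  by_contra hne
  have hr0 : 0 < ‖f x - y‖ := norm_pos_iff.2 (sub_ne_zero.2 hne)
  -- Comparison with `x₀`, whose value is at most `L * ε * ρ ≤ ν / 2 * ρ`, puts the minimiser in the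
  -- open ball; the nonzero residual makes the inequality strict.
  have hlt : ‖x - x₀‖ < ρ := by
    have h := hxmin (Metric.mem_closedBall_self hρ0)
    simp only [Set.mem_ofPred_eq, sub_self, norm_zero, mul_zero, add_zero] at h
    have h2 : ν / 2 * ‖x - x₀‖ < ν / 2 * ρ := by nlinarith
    exact lt_of_mul_lt_mul_left h2 (by positivity)
  refine hne (eq_of_local_min_norm (J := l + b x) (q := fun h => (1 / 2 : ℝ) • b h h)
    (x₀ := x₀) (c := ν / 2) (μ := ν - L * ε) (δ := ρ - ‖x - x₀‖) (sub_pos.2 hlt) (by linarith)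
    ?_ ?_ (by linarith) ?_)
  · intro s h
    simp only [hf, map_add, map_smul, _root_.add_apply,
        _root_.smul_apply, hsymm h x]
    module
  · intro w
    have h1 : ‖(b x).adjoint w‖ ≤ L * ε * ‖w‖ := by
      refine ((b x).adjoint.le_opNorm w).trans (mul_le_mul_of_nonneg_right ?_ (norm_nonneg _))
      rw [LinearIsometryEquiv.norm_map]
      exact (hb x).trans (mul_le_mul_of_nonneg_left (hsub x hxmem) hL)
    have h2 : ‖l.adjoint w‖ ≤ ‖(l + b x).adjoint w‖ + ‖(b x).adjoint w‖ := by
      rw [map_add, _root_.add_apply]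
      exact norm_le_add_norm_add _ _
    linarith [hl w]
  · intro z hz
    refine hxmin (mem_closedBall_iff_norm.2 ?_)
    calc ‖z - x₀‖ = ‖(z - x) + (x - x₀)‖ := by congr 1; abel
      _ ≤ ‖z - x‖ + ‖x - x₀‖ := norm_add_le _ _
      _ ≤ ρ := by linarith

end QuadraticImage
end QuadraticMap_Local

noncomputable section
namespace QuadraticMap_Local
open scoped InnerProductSpace Kronecker

variable {n m : ℕ}

/-! ### Eigenvalue bounds -/

section Spectrum

variable {k : ℕ} {M : Matrix (Fin k) (Fin k) ℝ}

theorem lambdaMin_mul_le (hM : M.IsHermitian) (w : Fin k → ℝ) :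
    lambdaMin M * (w ⬝ᵥ w) ≤ w ⬝ᵥ M.mulVec w := by
  have h : (M - algebraMap ℝ _ (lambdaMin M)).PosSemidef := by
    rw [Matrix.posSemidef_iff_isHermitian_and_spectrum_nonneg]
    refine ⟨hM.sub ?_, fun x hx => ?_⟩
    · simp [Matrix.IsHermitian, Matrix.algebraMap_eq_diagonal]
    · rw [← spectrum.sub_singleton_eq] at hx
      obtain ⟨z, hz, _, rfl, rfl⟩ := Set.mem_sub.1 hx
      exact sub_nonneg.2 (csInf_le M.finite_real_spectrum.bddBelow hz)
  have := h.dotProduct_mulVec_nonneg w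
  rw [Matrix.sub_mulVec, Algebra.algebraMap_eq_smul_one, Matrix.smul_mulVec, Matrix.one_mulVec,
    star_trivial, dotProduct_sub, dotProduct_smul, smul_eq_mul] at this
  linarith

theorem le_lambdaMax_mul (hM : M.IsHermitian) (w : Fin k → ℝ) :
    w ⬝ᵥ M.mulVec w ≤ lambdaMax M * (w ⬝ᵥ w) := by
  have h : (algebraMap ℝ _ (lambdaMax M) - M).PosSemidef := by
    rw [Matrix.posSemidef_iff_isHermitian_and_spectrum_nonneg]
    refine ⟨Matrix.IsHermitian.sub ?_ hM, fun x hx => ?_⟩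
    · simp [Matrix.IsHermitian, Matrix.algebraMap_eq_diagonal]
    · rw [← spectrum.singleton_sub_eq] at hx
      obtain ⟨_, rfl, z, hz, rfl⟩ := Set.mem_sub.1 hx
      exact sub_nonneg.2 (le_csSup M.finite_real_spectrum.bddAbove hz)
  have := h.dotProduct_mulVec_nonneg w
  rw [Matrix.sub_mulVec, Algebra.algebraMap_eq_smul_one, Matrix.smul_mulVec, Matrix.one_mulVec,
    star_trivial, dotProduct_sub, dotProduct_smul, smul_eq_mul] at this
  linarith

/-- **Samuelson's inequality**. -/
theorem le_mean_add_sqrt (e : Fin k → ℝ) (i : Fin k) :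
    e i ≤ (∑ j, e j) / k +
      Real.sqrt ((((k : ℝ) - 1) / k) * (∑ j, e j ^ 2 - (∑ j, e j) ^ 2 / k)) := by
  have hk : (0 : ℝ) < k := by exact_mod_cast i.pos
  set t := ∑ j, e j with ht
  set d : Fin k → ℝ := fun j => e j - t / k with hd
  have hsum : ∑ j, d j = 0 := by
    simp only [hd, Finset.sum_sub_distrib, Finset.sum_const, Finset.card_univ, Fintype.card_fin,
      nsmul_eq_mul, ← ht]
    field_simp; ring
  have hsq : ∑ j, d j ^ 2 = ∑ j, e j ^ 2 - t ^ 2 / k := by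
    simp only [hd, sub_sq, Finset.sum_sub_distrib, Finset.sum_add_distrib, Finset.sum_const,
      Finset.card_univ, Fintype.card_fin, nsmul_eq_mul, mul_assoc, ← Finset.mul_sum,
      ← Finset.sum_mul, ← ht]
    field_simp; ring
  have h1 : ∑ j ∈ Finset.univ.erase i, d j = - d i := by
    rw [← Finset.add_sum_erase _ _ (Finset.mem_univ i)] at hsum; linarith
  have h2 : ∑ j ∈ Finset.univ.erase i, d j ^ 2 = ∑ j, e j ^ 2 - t ^ 2 / k - d i ^ 2 := by
    rw [← hsq, ← Finset.add_sum_erase _ _ (Finset.mem_univ i)]; ring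
  -- Cauchy–Schwarz on the other `k - 1` deviations, whose sum is `-d i`.
  have h3 := sq_sum_le_card_mul_sum_sq (s := Finset.univ.erase i) (f := d)
  rw [h1, h2, Finset.card_erase_of_mem (Finset.mem_univ i), Finset.card_univ, Fintype.card_fin,
    Nat.cast_sub i.pos, Nat.cast_one] at h3
  have h4 : d i ≤ Real.sqrt ((((k : ℝ) - 1) / k) * (∑ j, e j ^ 2 - t ^ 2 / k)) := by
    apply Real.le_sqrt_of_sq_le
    rw [div_mul_eq_mul_div, le_div_iff₀ hk]
    nlinarith
  simp only [hd] at h4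
  linarith

theorem trace_mul_self_eq_sum_eigenvalues_sq (hM : M.IsHermitian) :
    (M * M).trace = ∑ i, hM.eigenvalues i ^ 2 := by
  conv_lhs => rw [hM.spectral_theorem]
  rw [← map_mul, Unitary.conjStarAlgAut_apply, Matrix.trace_mul_cycle,
    Unitary.coe_star_mul_self, one_mul, Matrix.diagonal_mul_diagonal, Matrix.trace_diagonal]
  simp [sq]

theorem lambdaMax_le_traceDiskBound (hk : 1 ≤ k) (hM : M.IsHermitian) :
    lambdaMax M ≤ traceDiskBound M := by
  have : Nonempty (Fin k) := ⟨⟨0, hk⟩⟩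
  rw [lambdaMax, hM.spectrum_real_eq_range_eigenvalues]
  refine csSup_le (Set.range_nonempty _) ?_
  rintro _ ⟨i, rfl⟩
  have h := le_mean_add_sqrt hM.eigenvalues i
  have hT : M.transpose = M := by simpa using hM.eq
  have ht : M.trace = ∑ i, hM.eigenvalues i := by simpa using hM.trace_eq_sum_eigenvalues
  rwa [traceDiskBound, hT, trace_mul_self_eq_sum_eigenvalues_sq hM, ht]

/-- Cauchy–Schwarz on the diagonal, whose squares are part of the Frobenius norm. It makes the
second radicand nonnegative at lifted points. -/
theorem trace_sq_div_le (M : Matrix (Fin k) (Fin k) ℝ) :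
    M.trace ^ 2 / k ≤ (M.transpose * M).trace := by
  rcases Nat.eq_zero_or_pos k with rfl | hk
  · simp [Matrix.trace]
  have hk : (0 : ℝ) < k := by exact_mod_cast hk
  have h1 := sq_sum_le_card_mul_sum_sq (s := Finset.univ) (f := fun i => M i i)
  rw [Finset.card_univ, Fintype.card_fin] at h1
  rw [div_le_iff₀ hk, mul_comm]
  refine h1.trans (mul_le_mul_of_nonneg_left (Finset.sum_le_sum fun i _ => ?_) hk.le)
  rw [Matrix.diag_apply, Matrix.mul_apply]
  have := Finset.single_le_sum (f := fun j => M.transpose i j * M j i)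
    (fun j _ => mul_self_nonneg (M j i)) (Finset.mem_univ i)
  simpa [sq] using this

end Spectrum

/-! ### Concavity and compactness of the program -/

section Program

/-- `Z ↦ M • Z` as a linear map. -/
def matInnerLin {ι : Type*} [Fintype ι] (M : Matrix ι ι ℝ) : Matrix ι ι ℝ →ₗ[ℝ] ℝ where
  toFun := matInner M
  map_add' X Y := by simp [matInner, Matrix.mul_add]
  map_smul' c X := by simp [matInner]

theorem continuous_matInner {ι : Type*} [Fintype ι] (M : Matrix ι ι ℝ) :
    Continuous (matInner M) := by
  unfold matInner; fun_prop

theorem concaveOn_sqrt_matInner {ι : Type*} [Fintype ι] (M : Matrix ι ι ℝ) :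
    ConcaveOn ℝ {Z | 0 ≤ matInner M Z} fun Z => Real.sqrt (matInner M Z) :=
  Real.strictConcaveOn_sqrt.concaveOn.comp_linearMap (matInnerLin M)

theorem convex_constraintSet (n : ℕ) : Convex ℝ (constraintSet n) := by
  rintro X ⟨hX1, hX2, hX3, hX4⟩ Y ⟨hY1, hY2, hY3, hY4⟩ s t hs ht hst
  refine ⟨?_, ?_, ?_, (hX4.smul hs).add (hY4.smul ht)⟩
  · simp [Matrix.trace_add, Matrix.trace_smul, hX1, hY1, hst]
  · simp [Matrix.add_mulVec, Matrix.smul_mulVec, dotProduct_add, hX2, hY2, hst]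
  · rw [Matrix.add_mulVec, Matrix.smul_mulVec, Matrix.smul_mulVec, WithLp.toLp_add,
      WithLp.toLp_smul, WithLp.toLp_smul]
    simpa using (convex_closedBall (0 : EuclideanSpace ℝ (Fin n × Fin n)) 1)
      (mem_closedBall_zero_iff.2 hX3) (mem_closedBall_zero_iff.2 hY3) hs ht hst

theorem concaveOn_objective (hm : 1 ≤ m) (A : Fin m → Matrix (Fin n) (Fin n) ℝ) :
    ConcaveOn ℝ (feasibleSet A) (objective A) := by
  have hm' : (1 : ℝ) ≤ m := by exact_mod_cast hm
  have h1 := concaveOn_sqrt_matInner (kronOne A)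
  have h2 := concaveOn_sqrt_matInner (kronTwo A)
  have hconv : Convex ℝ (feasibleSet A) := (convex_constraintSet n).inter (h1.1.inter h2.1)
  exact ((h1.subset (fun Z hZ => hZ.2.1) hconv).smul (by positivity : (0 : ℝ) ≤ 1 / m)).add
    ((h2.subset (fun Z hZ => hZ.2.2) hconv).smul (Real.sqrt_nonneg (((m : ℝ) - 1) / m)))

theorem isClosed_posSemidef {ι : Type*} [Fintype ι] :
    IsClosed {Z : Matrix ι ι ℝ | Z.PosSemidef} := by
  simp only [Matrix.posSemidef_iff_dotProduct_mulVec, Set.ofPred_and, Set.ofPred_forall,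
    Matrix.IsHermitian]
  refine (isClosed_eq (by fun_prop) (by fun_prop)).inter (isClosed_iInter fun x =>
    isClosed_le (by fun_prop) (by fun_prop))

/-- Testing on `e_p ± e_q` gives `2 * |Z p q| ≤ Z p p + Z q q`. With trace one this bounds the
feasible set. -/
theorem abs_apply_le_trace {ι : Type*} [Fintype ι] [DecidableEq ι] {Z : Matrix ι ι ℝ}
    (hZ : Z.PosSemidef) (p q : ι) : |Z p q| ≤ Z.trace := by
  have hs : Z q p = Z p q := by simpa using hZ.1.apply p q
  have hd : ∀ p, Z p p ≤ Z.trace := fun p =>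
    Finset.single_le_sum (f := fun i => Z i i) (fun i _ => hZ.diag_nonneg) (Finset.mem_univ p)
  have h : ∀ c : ℝ, 0 ≤ Z p p + c * Z p q + c * (Z p q + c * Z q q) := fun c => by
    have := hZ.dotProduct_mulVec_nonneg (Pi.single p 1 + c • Pi.single q 1)
    simpa [Matrix.mulVec_add, Matrix.mulVec_smul, add_dotProduct, dotProduct_add, hs] using this
  have h1 := h 1
  have h2 := h (-1)
  rw [abs_le]
  constructor <;> linarith [hd p, hd q]

theorem isCompact_feasibleSet (A : Fin m → Matrix (Fin n) (Fin n) ℝ) :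
    IsCompact (feasibleSet A) := by
  have hK : IsCompact (Set.univ.pi fun _ => Set.univ.pi fun _ => Set.Icc (-1) 1 :
      Set (Matrix (Fin n × Fin n) (Fin n × Fin n) ℝ)) :=
    isCompact_univ_pi fun _ => isCompact_univ_pi fun _ => isCompact_Icc
  refine hK.of_isClosed_subset ?_ ?_
  · have h1 : Continuous fun Z : Matrix (Fin n × Fin n) (Fin n × Fin n) ℝ => Z.trace := by
      fun_prop
    have h2 : Continuous fun Z : Matrix (Fin n × Fin n) (Fin n × Fin n) ℝ =>
        vecId n ⬝ᵥ Z.mulVec (vecId n) := by fun_prop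
    have h3 : Continuous fun Z : Matrix (Fin n × Fin n) (Fin n × Fin n) ℝ =>
        ‖WithLp.toLp 2 (Z.mulVec (vecId n))‖ := by fun_prop
    exact ((isClosed_eq h1 continuous_const).inter ((isClosed_eq h2 continuous_const).inter
      ((isClosed_le h3 continuous_const).inter isClosed_posSemidef))).inter
      ((isClosed_le continuous_const (continuous_matInner _)).inter
        (isClosed_le continuous_const (continuous_matInner _)))
  · rintro Z ⟨⟨h1, -, -, h4⟩, -⟩ p - q -
    exact abs_le.1 (h1 ▸ abs_apply_le_trace h4 p q)

theorem continuous_objective (A : Fin m → Matrix (Fin n) (Fin n) ℝ) :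
    Continuous (objective A) :=
  (continuous_const.mul (continuous_matInner _).sqrt).add
    (continuous_const.mul (continuous_matInner _).sqrt)

theorem objective_nonneg (A : Fin m → Matrix (Fin n) (Fin n) ℝ) (Z) : 0 ≤ objective A Z := by
  unfold objective; positivity

end Program

/-! ### Rank-one feasible points -/

section LiftPoint

variable (A : Fin m → Matrix (Fin n) (Fin n) ℝ) (y : EuclideanSpace ℝ (Fin n))

theorem matInner_kronecker_liftPoint (M N : Matrix (Fin n) (Fin n) ℝ) :
    matInner (M ⊗ₖ N) (liftPoint y)
      = (y.ofLp ⬝ᵥ M.mulVec y.ofLp) * (y.ofLp ⬝ᵥ N.mulVec y.ofLp) := by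
  set z : Fin n × Fin n → ℝ := fun p => y.ofLp p.1 * y.ofLp p.2 with hz
  have h : (M ⊗ₖ N).mulVec z
      = fun p => M.mulVec y.ofLp p.1 * N.mulVec y.ofLp p.2 := by
    ext p
    simp only [hz, Matrix.mulVec, dotProduct, Fintype.sum_prod_type, Finset.sum_mul_sum,
      Matrix.kroneckerMap_apply, mul_mul_mul_comm]
  rw [matInner, liftPoint, Matrix.transpose_vecMulVec, Matrix.mul_vecMulVec,
    Matrix.trace_vecMulVec, ← hz, h]
  simp only [hz, dotProduct, Fintype.sum_prod_type, Finset.sum_mul_sum]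
  exact Finset.sum_congr rfl fun i _ => Finset.sum_congr rfl fun j _ => by ring

theorem gramAt_apply (i j : Fin m) :
    gramAt A y i j = y.ofLp ⬝ᵥ ((A i).transpose * A j).mulVec y.ofLp := by
  rw [← Matrix.mulVec_mulVec, Matrix.dotProduct_mulVec, Matrix.vecMul_transpose]
  rfl

theorem isHermitian_gramAt : (gramAt A y).IsHermitian :=
  Matrix.isHermitian_conjTranspose_mul_self _

theorem trace_gramAt : (gramAt A y).trace = y.ofLp ⬝ᵥ (gramSum A).mulVec y.ofLp := by
  simp only [Matrix.trace, Matrix.diag_apply, gramAt_apply, gramSum, Matrix.sum_mulVec,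
    dotProduct_sum]

theorem trace_gramAt_nonneg : 0 ≤ (gramAt A y).trace :=
  (Matrix.posSemidef_conjTranspose_mul_self _).trace_nonneg

theorem matInner_kronOne_liftPoint :
    matInner (kronOne A) (liftPoint y) = (gramAt A y).trace ^ 2 := by
  rw [kronOne, matInner_kronecker_liftPoint, trace_gramAt, sq]

/-- Each Kronecker square evaluates to the square of a Gram entry, and these add up to the Frobenius
norm squared. -/
theorem matInner_kronTwo_liftPoint :
    matInner (kronTwo A) (liftPoint y)
      = ((gramAt A y).transpose * gramAt A y).trace - (gramAt A y).trace ^ 2 / m := by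
  have h1 : matInner (kronTwo A) (liftPoint y)
      = ∑ i, ∑ j, matInner (((A i).transpose * A j) ⊗ₖ ((A i).transpose * A j)) (liftPoint y)
        - 1 / (m : ℝ) * matInner (kronOne A) (liftPoint y) := by
    simp [matInner, kronTwo, Matrix.sub_mul, Matrix.sum_mul, Matrix.trace_sum]
  rw [h1, matInner_kronOne_liftPoint]
  simp only [matInner_kronecker_liftPoint, ← gramAt_apply, Matrix.trace, Matrix.diag_apply,
    Matrix.mul_apply, Matrix.transpose_apply]
  rw [Finset.sum_comm]
  ring

theorem objective_liftPoint (hm : 1 ≤ m) :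
    objective A (liftPoint y) = traceDiskBound (gramAt A y) := by
  have hm' : (1 : ℝ) ≤ m := by exact_mod_cast hm
  rw [objective, traceDiskBound, matInner_kronOne_liftPoint, matInner_kronTwo_liftPoint,
    Real.sqrt_sq (trace_gramAt_nonneg A y),
    Real.sqrt_mul (div_nonneg (by linarith) (by linarith))]
  ring

theorem liftPoint_mem_feasibleSet (hy : ‖y‖ = 1) : liftPoint y ∈ feasibleSet A := by
  set z : Fin n × Fin n → ℝ := fun p => y.ofLp p.1 * y.ofLp p.2 with hz
  have hy2 : ∑ i, y.ofLp i * y.ofLp i = 1 := by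
    have := EuclideanSpace.real_norm_sq_eq y
    rw [hy, one_pow] at this
    simp only [← sq, ← this]
  have hzz : z ⬝ᵥ z = 1 := by
    simp only [hz, dotProduct, Fintype.sum_prod_type, mul_mul_mul_comm, ← Finset.mul_sum, hy2,
      mul_one]
  -- Pairing `vec(I)` with `y ⊗ y` gives `‖y‖ ^ 2`, so `z zᵀ` sends `vec(I)` to `z`.
  have hv : vecId n ⬝ᵥ z = 1 := by
    simp only [vecId, hz, dotProduct, Fintype.sum_prod_type, Matrix.vec, Matrix.one_apply,
      ite_mul, one_mul, zero_mul, Finset.sum_ite_eq', Finset.mem_univ, if_true,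
      hy2]
  have hZv : (liftPoint y).mulVec (vecId n) = z := by
    rw [liftPoint, Matrix.vecMulVec_mulVec, dotProduct_comm, ← hz, hv]; simp
  refine ⟨⟨?_, ?_, ?_, ?_⟩, ?_, ?_⟩
  · rw [liftPoint, Matrix.trace_vecMulVec, ← hz, hzz]
  · rw [hZv, hv]
  · rw [hZv, ← sq_le_one_iff₀ (norm_nonneg _), EuclideanSpace.real_norm_sq_eq]
    simp only [sq]
    exact hzz.le
  · exact Matrix.posSemidef_vecMulVec_self_star z
  · rw [matInner_kronOne_liftPoint]; positivity
  · rw [matInner_kronTwo_liftPoint]; exact sub_nonneg.2 (trace_sq_div_le _)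

end LiftPoint

theorem isGreatest_LTilde_sq (hn : 1 ≤ n) (A : Fin m → Matrix (Fin n) (Fin n) ℝ) :
    IsGreatest (objective A '' feasibleSet A) (LTilde A ^ 2) := by
  have hne : (feasibleSet A).Nonempty :=
    ⟨_, liftPoint_mem_feasibleSet A (EuclideanSpace.single ⟨0, hn⟩ 1) (by simp)⟩
  obtain ⟨Z, hZ, hmax⟩ := (isCompact_feasibleSet A).exists_isMaxOn hne
    (continuous_objective A).continuousOn
  have h : IsGreatest (objective A '' feasibleSet A) (objective A Z) :=
    ⟨⟨Z, hZ, rfl⟩, by rintro _ ⟨X, hX, rfl⟩; exact hmax hX⟩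
  rw [LTilde, h.csSup_eq, Real.sq_sqrt (objective_nonneg A Z)]
  exact h

/-! ### Derivative bounds and convexity of the image -/

section Image

/-- The linear map `h ↦ (v_1ᵀ h, …, v_mᵀ h)`, which depends linearly on the `v_i`. -/
def colForm (v : Fin m → Fin n → ℝ) : EuclideanSpace ℝ (Fin n) →L[ℝ] EuclideanSpace ℝ (Fin m) :=
  (Matrix.toEuclideanLin (colMatrix v).transpose).toContinuousLinearMap

theorem colForm_apply (v : Fin m → Fin n → ℝ) (h : EuclideanSpace ℝ (Fin n)) (i : Fin m) :
    colForm v h i = v i ⬝ᵥ h.ofLp := rfl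

theorem colForm_adjoint_apply (v : Fin m → Fin n → ℝ) (w : EuclideanSpace ℝ (Fin m)) :
    (colForm v).adjoint w = WithLp.toLp 2 ((colMatrix v).mulVec w.ofLp) := by
  refine ext_inner_right ℝ fun h => ?_
  rw [ContinuousLinearMap.adjoint_inner_left, EuclideanSpace.inner_eq_star_dotProduct,
    EuclideanSpace.inner_eq_star_dotProduct, star_trivial, star_trivial]
  change (colMatrix v).transpose.mulVec h.ofLp ⬝ᵥ w.ofLp = h.ofLp ⬝ᵥ (colMatrix v).mulVec w.ofLp
  rw [Matrix.dotProduct_mulVec, Matrix.mulVec_transpose]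

theorem norm_sq_colForm_adjoint (v : Fin m → Fin n → ℝ) (w : EuclideanSpace ℝ (Fin m)) :
    ‖(colForm v).adjoint w‖ ^ 2
      = w.ofLp ⬝ᵥ ((colMatrix v).transpose * colMatrix v).mulVec w.ofLp := by
  rw [colForm_adjoint_apply, ← Matrix.mulVec_mulVec, Matrix.dotProduct_mulVec,
    Matrix.vecMul_transpose, EuclideanSpace.real_norm_sq_eq]
  simp only [sq, dotProduct]

theorem dotProduct_self_eq_norm_sq (w : EuclideanSpace ℝ (Fin m)) :
    w.ofLp ⬝ᵥ w.ofLp = ‖w‖ ^ 2 := by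
  rw [EuclideanSpace.real_norm_sq_eq]
  simp only [sq, dotProduct]

theorem nu_mul_norm_le (a : Fin m → Fin n → ℝ) (w : EuclideanSpace ℝ (Fin m)) :
    nu a * ‖w‖ ≤ ‖(colForm a).adjoint w‖ := by
  have h := lambdaMin_mul_le (Matrix.isHermitian_conjTranspose_mul_self (colMatrix a)) w.ofLp
  rw [Matrix.conjTranspose_eq_transpose_of_trivial, dotProduct_self_eq_norm_sq,
    ← norm_sq_colForm_adjoint] at h
  -- `Real.sqrt_mul'` needs only the factor `‖w‖ ^ 2` to be nonnegative, so the sign of `lambdaMin`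
  -- plays no role.
  rw [nu, ← Real.sqrt_sq (norm_nonneg w), ← Real.sqrt_mul' _ (sq_nonneg _),
    ← Real.sqrt_sq (norm_nonneg ((colForm a).adjoint w))]
  exact Real.sqrt_le_sqrt h

/-- The second derivative of `quadMap`. -/
def hessian (A : Fin m → Matrix (Fin n) (Fin n) ℝ) :
    EuclideanSpace ℝ (Fin n) →L[ℝ] EuclideanSpace ℝ (Fin n) →L[ℝ] EuclideanSpace ℝ (Fin m) :=
  LinearMap.toContinuousLinearMap
    { toFun := fun x => colForm fun i => (A i).mulVec x.ofLp
      map_add' := fun x y => by ext h i; simp [colForm_apply, Matrix.mulVec_add, add_dotProduct]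
      map_smul' := fun c x => by ext h i; simp [colForm_apply, Matrix.mulVec_smul] }

theorem hessian_apply (A : Fin m → Matrix (Fin n) (Fin n) ℝ) (x : EuclideanSpace ℝ (Fin n)) :
    hessian A x = colForm fun i => (A i).mulVec x.ofLp := rfl

theorem norm_hessian_le_of_norm_eq_one (hn : 1 ≤ n) (hm : 1 ≤ m)
    (A : Fin m → Matrix (Fin n) (Fin n) ℝ) {x : EuclideanSpace ℝ (Fin n)} (hx : ‖x‖ = 1) :
    ‖hessian A x‖ ≤ LTilde A := by
  have hL : 0 ≤ LTilde A := Real.sqrt_nonneg _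
  -- The adjoint has the same norm, and its squared length at `w` is the quadratic form of `gramAt A
  -- x`.
  rw [← LinearIsometryEquiv.norm_map ContinuousLinearMap.adjoint, hessian_apply]
  refine ContinuousLinearMap.opNorm_le_bound _ hL fun w => ?_
  have h1 : lambdaMax (gramAt A x) ≤ LTilde A ^ 2 :=
    (lambdaMax_le_traceDiskBound hm (isHermitian_gramAt A x)).trans
      ((objective_liftPoint A x hm).symm.trans_le
        ((isGreatest_LTilde_sq hn A).2 ⟨_, liftPoint_mem_feasibleSet A x hx, rfl⟩))
  have h2 := le_lambdaMax_mul (isHermitian_gramAt A x) w.ofLp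
  rw [dotProduct_self_eq_norm_sq] at h2
  refine le_of_sq_le_sq ?_ (by positivity)
  rw [norm_sq_colForm_adjoint, mul_pow]
  exact h2.trans (mul_le_mul_of_nonneg_right h1 (sq_nonneg _))

theorem norm_hessian_le (hn : 1 ≤ n) (hm : 1 ≤ m) (A : Fin m → Matrix (Fin n) (Fin n) ℝ)
    (x : EuclideanSpace ℝ (Fin n)) : ‖hessian A x‖ ≤ LTilde A * ‖x‖ := by
  rcases eq_or_ne x 0 with rfl | hx
  · simp
  have hx' : 0 < ‖x‖ := norm_pos_iff.2 hx
  have h := norm_hessian_le_of_norm_eq_one hn hm A (x := ‖x‖⁻¹ • x) (norm_smul_inv_norm hx)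
  rwa [map_smul, norm_smul, norm_inv, norm_norm, inv_mul_le_iff₀ hx', mul_comm] at h

theorem convex_ballImage (hn : 1 ≤ n) (hm : 1 ≤ m) {A : Fin m → Matrix (Fin n) (Fin n) ℝ}
    (hA : ∀ i, (A i).IsSymm) (a : Fin m → Fin n → ℝ) {ε : ℝ} (hε : 2 * LTilde A * ε < nu a) :
    Convex ℝ (ballImage A a ε) := by
  have hsymm : ∀ x y, hessian A x y = hessian A y x := fun x y => by
    ext i
    rw [hessian_apply, hessian_apply, colForm_apply, colForm_apply, dotProduct_comm,
      Matrix.dotProduct_mulVec, ← Matrix.mulVec_transpose, (hA i).eq]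
  have h := convex_quadratic_image_ball (colForm a) (hessian A) hsymm (Real.sqrt_nonneg _)
    (norm_hessian_le hn hm A) (nu_mul_norm_le a) hε
  have hmap : ∀ x, quadMap A a x = colForm a x + (1 / 2 : ℝ) • hessian A x x := fun x => by
    ext i
    simp only [quadMap, PiLp.add_apply, PiLp.smul_apply, hessian_apply, colForm_apply, smul_eq_mul]
    rw [dotProduct_comm x.ofLp, add_comm]
  have himage : ballImage A a ε = quadMap A a '' Metric.closedBall 0 ε :=
    Set.ext fun p => exists_congr fun x => by rw [mem_closedBall_zero_iff]
  rw [himage, funext hmap]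
  exact h

end Image
end QuadraticMap_Local
end

theorem mainTheorem4 {n m : ℕ} (hn : 1 ≤ n) (hm : 1 ≤ m)
    (A : Fin m → Matrix (Fin n) (Fin n) ℝ) (hA : ∀ i, (A i).IsSymm)
    (a : Fin m → Fin n → ℝ) :
    -- the program is convex: a concave objective on a convex feasible set
    ConcaveOn ℝ (QuadraticMap_Local.feasibleSet A) (QuadraticMap_Local.objective A) ∧
    -- its maximum is attained and equals the square of the constant
    IsGreatest (QuadraticMap_Local.objective A '' QuadraticMap_Local.feasibleSet A)
      (QuadraticMap_Local.LTilde A ^ 2) ∧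
    -- it relaxes the trace-based disk bound for the eigenvalues
    (∀ y : EuclideanSpace ℝ (Fin n), ‖y‖ = 1 →
      QuadraticMap_Local.lambdaMax (QuadraticMap_Local.gramAt A y)
          ≤ QuadraticMap_Local.traceDiskBound (QuadraticMap_Local.gramAt A y) ∧
      QuadraticMap_Local.liftPoint y ∈ QuadraticMap_Local.feasibleSet A ∧
      QuadraticMap_Local.objective A (QuadraticMap_Local.liftPoint y)
          = QuadraticMap_Local.traceDiskBound (QuadraticMap_Local.gramAt A y)) ∧
    -- `ε < ν / (2 L̃_new)`, the quotient being `+∞` if `L̃_new = 0 < ν`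
    (∀ ε : ℝ, 2 * QuadraticMap_Local.LTilde A * ε < QuadraticMap_Local.nu a →
      Convex ℝ (QuadraticMap_Local.ballImage A a ε)) :=
  ⟨QuadraticMap_Local.concaveOn_objective hm A, QuadraticMap_Local.isGreatest_LTilde_sq hn A,
    fun y hy => ⟨QuadraticMap_Local.lambdaMax_le_traceDiskBound hm
        (QuadraticMap_Local.isHermitian_gramAt A y),
      QuadraticMap_Local.liftPoint_mem_feasibleSet A y hy,
      QuadraticMap_Local.objective_liftPoint A y hm⟩,
    fun _ hε => QuadraticMap_Local.convex_ballImage hn hm hA a hε⟩
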